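/- Let $\mathbb T^d=\mathbb R^d/\mathbb Z^d$, let $X=L^2(\mathbb T^d)\times H^1(\mathbb T^d)$ with $\|(m,u)\|_X^2=\|m\|_{L^2}^2+\|u\|_{L^2}^2+\|Du\|_{L^2}^2$, and let $$K=\Big\{(m,u)\in X:\ m\ge 0\text{ a.e.},\ \int_{\mathbb T^d}m\,dx=1\Big\}.$$ Let $V\in L^\infty(\mathbb T^d)$, and let $H:\mathbb R^d\times[0,\infty)\to\mathbb R$ be of class $C^1$ such that * (H1) $p\mapsto H(p,m)$ is convex for each $m\ge0$, and $m\mapsto H(p,m)$ is nonincreasing for each $p$; * (H2) for all $p_1,p_2\in\mathbb R^d$ and $m_1,m_2\ge0$, $$\big(-H(p_1,m_1)+H(p_2,m_2)\big)(m_1-m_2)+\big(m_1D_pH(p_1,m_1)-m_2D_pH(p_2,m_2)\big)\cdot(p_1-p_2)\ge0,$$ with strict inequality if $(p_1,m_1)\ne(p_2,m_2)$ and $m_1+m_2>0$; * (H3) there is $C>0$ with $|H(p,m)|+|D_pH(p,m)|^2\le C(1+|p|^2+m^2)$ for all $p\in\mathbb R^d$, $m\ge0$. For $(m,u),(\mu,v)\in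 X$ with $m\ge0$ put $$\langle A[m,u],(\mu,v)\rangle=\int_{\mathbb T^d}\big(-u-H(Du,m)-V\big)\mu\,dx+\int_{\mathbb T^d}\big(m\,D_pH(Du,m)\cdot Dv+(m-1)v\big)\,dx,$$ $$\langle B[m,u],(\mu,v)\rangle=\int_{\mathbb T^d}\big(m\mu+uv+Du\cdot Dv\big)\,dx .$$ For $\varepsilon>0$, a *regularised solution* is a pair $(m_\varepsilon,u_\varepsilon)\in X$ with $m_\varepsilon\ge0$ a.e. such that, for every $(\mu,v)\in X$, the integrals in $\langle A[m_\varepsilon,u_\varepsilon],(\mu,v)\rangle$ converge absolutely and $\langle A[m_\varepsilon,u_\varepsilon]+\varepsilon B[m_\varepsilon,u_\varepsilon],(\mu,v)\rangle=0$. (The mass of $m_\varepsilon$ is not prescribed; solutions in $K$ are a special case.) Let $\varepsilon_n>0$, $\varepsilon_n\to0$, let $(m_n,u_n)$ be regularised solutions for $\varepsilon_n$, and suppose that $m_n\rightharpoonup m$ weakly in $L^2(\mathbb T^d)$ and $u_n\rightharpoonup u$ weakly in $H^1(\mathbb T^d)$. Then: 1. $(m,u)\in K$. 2. $A[m,u]=0$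 in $X^*$, in the following sense: for all $(\mu,v)$ in the dense subspace $\{(\mu,v)\in X:\ \mu\in L^\infty,\ Dv\in L^\infty\}$ of $X$ the integrals in $\langle A[m,u],(\mu,v)\rangle$ converge absolutely and $\langle A[m,u],(\mu,v)\rangle=0$; moreover, if these integrals converge absolutely for every $(\mu,v)\in X$, then $\langle A[m,u],(\mu,v)\rangle=0$ for every $(\mu,v)\in X$. 3. $(m,u)$ is a strong solution of the MFG system: $-u-H(Du,m)-V=0$ a.e. in $\mathbb T^d$, and $m-\operatorname{div}\big(m\,D_pH(Du,m)\big)=1$ in the sense of distributions, that is, $m\,D_pH(Du,m)\in L^1(\mathbb T^d)$ and $$\int_{\mathbb T^d}m\varphi\,dx+\int_{\mathbb T^d}m\,D_pH(Du,m)\cdot D\varphi\,dx=\int_{\mathbb T^d}\varphi\,dx\qquad\forall\varphi\in C^\infty(\mathbb T^d).$$ -/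

import Mathlib

open MeasureTheory Filter Topology

noncomputable section

namespace MFG

/-! ### The flat torus, smooth functions and the spaces `L²`, `H¹`, `X` -/

/-- The flat torus `𝕋ᵈ = ℝᵈ / ℤᵈ`; its `volume` is the Lebesgue (probability) measure. -/
abbrev Torus (d : ℕ) : Type := UnitAddTorus (Fin d)

/-- `ℝᵈ` with its Euclidean norm and inner product. -/
abbrev Vec (d : ℕ) : Type := EuclideanSpace ℝ (Fin d)

/-- The quotient map `ℝᵈ → 𝕋ᵈ`. -/
def proj (d : ℕ) (y : Fin d → ℝ) : Torus d := fun i => (y i : UnitAddCircle)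

/-- `φ ∈ C^∞(𝕋ᵈ)`: the periodic lift of `φ` to `ℝᵈ` is smooth. -/
def SmoothOnTorus {d : ℕ} (φ : Torus d → ℝ) : Prop :=
  ContDiff ℝ (⊤ : ℕ∞) (fun y : Fin d → ℝ => φ (proj d y))

/-- The classical partial derivative `∂φ/∂xᵢ` of a function on the torus. -/
def partialDeriv {d : ℕ} (φ : Torus d → ℝ) (i : Fin d) (x : Torus d) : ℝ :=
  deriv (fun t : ℝ => φ (x + Pi.single i (t : UnitAddCircle))) 0

/-- The classical gradient `Dφ` of a function on the torus. -/
def torusGrad {d : ℕ} (φ : Torus d → ℝ) (x : Torus d) : Vec d :=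
  WithLp.toLp 2 (fun i => partialDeriv φ i x)

/-- `L²(𝕋ᵈ)`. -/
abbrev L2 (d : ℕ) : Type := Lp ℝ 2 (volume : Measure (Torus d))

/-- `L²(𝕋ᵈ; ℝᵈ)`. -/
abbrev L2Vec (d : ℕ) : Type := Lp (Vec d) 2 (volume : Measure (Torus d))

/-- `g` is the weak gradient of `u`: `∫ u ∂ᵢφ = -∫ gᵢ φ` for all `φ ∈ C^∞(𝕋ᵈ)` and all `i`. -/
def HasWeakGradient {d : ℕ} (u : L2 d) (g : L2Vec d) : Prop :=
  ∀ φ : Torus d → ℝ, SmoothOnTorus φ → ∀ i : Fin d,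
    ∫ x, u x * partialDeriv φ i x = -∫ x, g x i * φ x

theorem isOpenQuotientMap_proj (d : ℕ) : IsOpenQuotientMap (proj d) :=
  IsOpenQuotientMap.piMap (fun _ => QuotientAddGroup.isOpenQuotientMap_mk)

theorem SmoothOnTorus.continuous {d : ℕ} {φ : Torus d → ℝ} (h : SmoothOnTorus φ) :
    Continuous φ :=
  (isOpenQuotientMap_proj d).isQuotientMap.continuous_iff.2 (ContDiff.continuous h)

theorem SmoothOnTorus.partialDeriv_proj {d : ℕ} {φ : Torus d → ℝ} (h : SmoothOnTorus φ)
    (i : Fin d) (y : Fin d → ℝ) :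
    partialDeriv φ i (proj d y) =
      fderiv ℝ (fun y : Fin d → ℝ => φ (proj d y)) y (Pi.single i 1) := by
  have h1 : ∀ t : ℝ, proj d y + Pi.single i (t : UnitAddCircle)
      = proj d (y + t • Pi.single i (1 : ℝ)) := by
    intro t
    funext j
    by_cases hj : j = i
    · subst hj; simp [proj]
    · simp [proj, hj]
  have h2 : HasFDerivAt (fun y : Fin d → ℝ => φ (proj d y))
      (fderiv ℝ (fun y : Fin d → ℝ => φ (proj d y)) y) y :=
    ((ContDiff.differentiable h (by simp)) y).hasFDerivAt
  have h3 : HasDerivAt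
      (fun t : ℝ => (fun y : Fin d → ℝ => φ (proj d y)) (y + t • Pi.single i (1 : ℝ)))
      (fderiv ℝ (fun y : Fin d → ℝ => φ (proj d y)) y (Pi.single i 1)) 0 :=
    h2.hasLineDerivAt (Pi.single i 1)
  unfold partialDeriv
  simp only [h1]
  exact h3.deriv

theorem SmoothOnTorus.continuous_partialDeriv {d : ℕ} {φ : Torus d → ℝ}
    (h : SmoothOnTorus φ) (i : Fin d) : Continuous (partialDeriv φ i) := by
  refine (isOpenQuotientMap_proj d).isQuotientMap.continuous_iff.2 ?_
  have h1 : partialDeriv φ i ∘ proj d =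
      fun y => fderiv ℝ (fun y : Fin d → ℝ => φ (proj d y)) y (Pi.single i 1) :=
    funext fun y => h.partialDeriv_proj i y
  rw [h1]
  exact (ContDiff.continuous_fderiv h (by simp)).clm_apply continuous_const

theorem integrable_mul_of_continuous {d : ℕ} {f φ : Torus d → ℝ}
    (hf : MemLp f 2 volume) (hφ : Continuous φ) : Integrable (fun x => f x * φ x) volume := by
  obtain ⟨C, hC⟩ := isCompact_univ.exists_bound_of_continuousOn hφ.continuousOn
  exact (hf.integrable one_le_two).mul_bdd hφ.aestronglyMeasurable
    (ae_of_all _ fun x => hC x trivial)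

theorem memLp_coord {d : ℕ} (g : L2Vec d) (i : Fin d) :
    MemLp (fun x => g x i) 2 (volume : Measure (Torus d)) :=
  (EuclideanSpace.proj (𝕜 := ℝ) i : Vec d →L[ℝ] ℝ).comp_memLp' (Lp.memLp g)

theorem HasWeakGradient.add {d : ℕ} {u v : L2 d} {g k : L2Vec d}
    (hu : HasWeakGradient u g) (hv : HasWeakGradient v k) :
    HasWeakGradient (u + v) (g + k) := by
  intro φ hφ i
  have e1 : ∫ x, (u + v) x * partialDeriv φ i x =
      ∫ x, (u x * partialDeriv φ i x + v x * partialDeriv φ i x) := by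
    refine integral_congr_ae ?_
    filter_upwards [Lp.coeFn_add u v] with x hx
    rw [hx, Pi.add_apply, add_mul]
  have e2 : ∫ x, (g + k) x i * φ x = ∫ x, (g x i * φ x + k x i * φ x) := by
    refine integral_congr_ae ?_
    filter_upwards [Lp.coeFn_add g k] with x hx
    rw [hx, Pi.add_apply, PiLp.add_apply, add_mul]
  have c1 := hφ.continuous_partialDeriv i
  have c2 := hφ.continuous
  rw [e1, e2, integral_add (integrable_mul_of_continuous (Lp.memLp u) c1)
      (integrable_mul_of_continuous (Lp.memLp v) c1),
    integral_add (integrable_mul_of_continuous (memLp_coord g i) c2)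
      (integrable_mul_of_continuous (memLp_coord k i) c2), hu φ hφ i, hv φ hφ i]
  ring

theorem HasWeakGradient.smul {d : ℕ} {u : L2 d} {g : L2Vec d} (c : ℝ)
    (hu : HasWeakGradient u g) : HasWeakGradient (c • u) (c • g) := by
  intro φ hφ i
  have e1 : ∫ x, (c • u) x * partialDeriv φ i x = ∫ x, c * (u x * partialDeriv φ i x) := by
    refine integral_congr_ae ?_
    filter_upwards [Lp.coeFn_smul c u] with x hx
    rw [hx, Pi.smul_apply, smul_eq_mul, mul_assoc]
  have e2 : ∫ x, (c • g) x i * φ x = ∫ x, c * (g x i * φ x) := by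
    refine integral_congr_ae ?_
    filter_upwards [Lp.coeFn_smul c g] with x hx
    rw [hx, Pi.smul_apply, PiLp.smul_apply, smul_eq_mul, mul_assoc]
  rw [e1, e2, integral_const_mul, integral_const_mul, hu φ hφ i]
  ring

theorem HasWeakGradient.zero (d : ℕ) : HasWeakGradient (0 : L2 d) (0 : L2Vec d) := by
  intro φ _ i
  have e1 : ∫ x, (0 : L2 d) x * partialDeriv φ i x = 0 :=
    integral_eq_zero_of_ae (by simp; rfl)
  have e2 : ∫ x, (0 : L2Vec d) x i * φ x = 0 :=
    integral_eq_zero_of_ae (by simp; rfl)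
  rw [e1, e2, neg_zero]

/-- The Sobolev space `H¹(𝕋ᵈ)`, as the space of pairs `(u, Du)` in `L² × L²`, so that
`‖u‖² = ‖u‖²_{L²} + ‖Du‖²_{L²}`. -/
def H1 (d : ℕ) : Submodule ℝ (WithLp 2 (L2 d × L2Vec d)) where
  carrier := {w | HasWeakGradient w.fst w.snd}
  add_mem' := fun ha hb => HasWeakGradient.add ha hb
  zero_mem' := HasWeakGradient.zero d
  smul_mem' := fun c _ ha => HasWeakGradient.smul c ha

/-- The Hilbert space `X = L²(𝕋ᵈ) × H¹(𝕋ᵈ)`, with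
`‖(m,u)‖² = ‖m‖²_{L²} + ‖u‖²_{L²} + ‖Du‖²_{L²}`. -/
abbrev X (d : ℕ) : Type := WithLp 2 (L2 d × H1 d)

/-- The component `m` of `z = (m,u) ∈ X`, as a function. -/
def X.m {d : ℕ} (z : X d) : Torus d → ℝ := z.fst

/-- The component `u` of `z = (m,u) ∈ X`, as a function. -/
def X.u {d : ℕ} (z : X d) : Torus d → ℝ := z.snd.1.fst

/-- The weak gradient `Du` of the component `u` of `z = (m,u) ∈ X`. -/
def X.Du {d : ℕ} (z : X d) : Torus d → Vec d := z.snd.1.snd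

/-- `K = {(m,u) ∈ X : m ≥ 0 a.e., ∫ m = 1}`. -/
def K (d : ℕ) : Set (X d) := {z | (∀ᵐ x, 0 ≤ z.m x) ∧ ∫ x, z.m x = 1}

/-! ### The Hamiltonian -/

/-- `D_p H(p,m)`. -/
def gradP {d : ℕ} (H : Vec d → ℝ → ℝ) (p : Vec d) (m : ℝ) : Vec d :=
  gradient (fun q => H q m) p

/-- The assumptions on `H : ℝᵈ × [0,∞) → ℝ`. The values `H p m` with `m < 0` are irrelevant. -/
structure StructuralAssumptions {d : ℕ} (H : Vec d → ℝ → ℝ) : Prop where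
  contDiffOn : ContDiffOn ℝ 1 (fun y : Vec d × ℝ => H y.1 y.2) (Set.univ ×ˢ Set.Ici 0)
  convex : ∀ m : ℝ, 0 ≤ m → ConvexOn ℝ Set.univ (fun p => H p m)
  nonincreasing : ∀ p : Vec d, AntitoneOn (fun m => H p m) (Set.Ici 0)
  monotone : ∀ (p₁ p₂ : Vec d) (m₁ m₂ : ℝ), 0 ≤ m₁ → 0 ≤ m₂ →
    0 ≤ (-H p₁ m₁ + H p₂ m₂) * (m₁ - m₂)
      + inner ℝ (m₁ • gradP H p₁ m₁ - m₂ • gradP H p₂ m₂) (p₁ - p₂)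
  strict : ∀ (p₁ p₂ : Vec d) (m₁ m₂ : ℝ), 0 ≤ m₁ → 0 ≤ m₂ →
    (p₁, m₁) ≠ (p₂, m₂) → 0 < m₁ + m₂ →
    0 < (-H p₁ m₁ + H p₂ m₂) * (m₁ - m₂)
      + inner ℝ (m₁ • gradP H p₁ m₁ - m₂ • gradP H p₂ m₂) (p₁ - p₂)
  growth : ∃ C : ℝ, 0 < C ∧ ∀ (p : Vec d) (m : ℝ), 0 ≤ m →
    |H p m| + ‖gradP H p m‖ ^ 2 ≤ C * (1 + ‖p‖ ^ 2 + m ^ 2)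

/-! ### The operators `A`, `B` and the solutions -/

/-- The first integrand in `⟨A[m,u],(μ,v)⟩`: `(-u - H(Du,m) - V) μ`. -/
def integrandHJ {d : ℕ} (H : Vec d → ℝ → ℝ) (V : Torus d → ℝ) (z w : X d) (x : Torus d) : ℝ :=
  (-z.u x - H (z.Du x) (z.m x) - V x) * w.m x

/-- The second integrand in `⟨A[m,u],(μ,v)⟩`: `m D_pH(Du,m)·Dv + (m - 1) v`. -/
def integrandFP {d : ℕ} (H : Vec d → ℝ → ℝ) (z w : X d) (x : Torus d) : ℝ :=
  z.m x * inner ℝ (gradP H (z.Du x) (z.m x)) (w.Du x) + (z.m x - 1) * w.u x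

/-- Both integrals in `⟨A[z],w⟩` converge absolutely. -/
def PairingConverges {d : ℕ} (H : Vec d → ℝ → ℝ) (V : Torus d → ℝ) (z w : X d) : Prop :=
  Integrable (integrandHJ H V z w) volume ∧ Integrable (integrandFP H z w) volume

/-- `⟨A[z],w⟩`. -/
def pairingA {d : ℕ} (H : Vec d → ℝ → ℝ) (V : Torus d → ℝ) (z w : X d) : ℝ :=
  (∫ x, integrandHJ H V z w x) + ∫ x, integrandFP H z w x

/-- `⟨B[m,u],(μ,v)⟩ = ∫ (m μ + u v + Du·Dv)`. -/
def pairingB {d : ℕ} (z w : X d) : ℝ :=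
  ∫ x, (z.m x * w.m x + z.u x * w.u x + inner ℝ (z.Du x) (w.Du x))

/-- The dense subspace of directions `(μ,v) ∈ X` with `μ` and `Dv` essentially bounded. It contains
`C^∞ × C^∞`, and under the growth assumption the integrals in `⟨A[z],w⟩` converge for every `z ∈ K`
and every such direction `w`. -/
def IsBoundedDirection {d : ℕ} (w : X d) : Prop :=
  MemLp w.m ⊤ volume ∧ MemLp w.Du ⊤ volume

/-- `A[z] = ℓ` in `X*`: the integrals defining `⟨A[z],w⟩` converge and are equal to `ℓ w` for
all `w` in the dense subspace of bounded directions. -/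
def OperatorValue {d : ℕ} (H : Vec d → ℝ → ℝ) (V : Torus d → ℝ) (z : X d)
    (ℓ : StrongDual ℝ (X d)) : Prop :=
  ∀ w : X d, IsBoundedDirection w → PairingConverges H V z w ∧ pairingA H V z w = ℓ w

/-- `z = (m_ε,u_ε) ∈ X` with `m_ε ≥ 0` solves the regularised problem `(A + ε B)[z] = 0`: the
integrals in `⟨A[z],w⟩` converge for every `w ∈ X`, and `⟨A[z] + ε B[z],w⟩ = 0`. The mass of
`m_ε` is not prescribed. -/
structure IsRegularisedSolution {d : ℕ} (H : Vec d → ℝ → ℝ) (V : Torus d → ℝ) (ε : ℝ)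
    (z : X d) : Prop where
  nonneg : ∀ᵐ x, 0 ≤ z.m x
  converges : ∀ w : X d, PairingConverges H V z w
  eq_zero : ∀ w : X d, pairingA H V z w + ε * pairingB z w = 0

/-- `z = (m,u) ∈ K` is a strong solution of the MFG system: `-u - H(Du,m) - V = 0` a.e., and
`m - div(m D_pH(Du,m)) = 1` in the sense of distributions. -/
structure IsStrongSolution {d : ℕ} (H : Vec d → ℝ → ℝ) (V : Torus d → ℝ) (z : X d) : Prop where
  mem_K : z ∈ K d
  hamiltonJacobi : ∀ᵐ x, -z.u x - H (z.Du x) (z.m x) - V x = 0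
  fokkerPlanck_integrable : Integrable (fun x => z.m x • gradP H (z.Du x) (z.m x)) volume
  fokkerPlanck : ∀ φ : Torus d → ℝ, SmoothOnTorus φ →
    (∫ x, z.m x * φ x) + (∫ x, z.m x * inner ℝ (gradP H (z.Du x) (z.m x)) (torusGrad φ x))
      = ∫ x, φ x

/-- Weak convergence `zₙ ⇀ z` of a sequence in a normed space. -/
def WeaklyTendsto {E : Type*} [NormedAddCommGroup E] [NormedSpace ℝ E]
    (z : ℕ → E) (z₀ : E) : Prop :=
  Tendsto (fun n => toWeakSpace ℝ E (z n)) atTop (𝓝 (toWeakSpace ℝ E z₀))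

end MFG

end

noncomputable section

namespace MFG

/-! The key point is that the weak convergence is automatically strong. Two regularised solutions
may be tested against their difference, and monotonicity of `A` gives `0 ≤ ε_k ⟨z_k, z_n - z_k⟩ -
ε_n ⟨z_n, z_n - z_k⟩`, because `B` is the inner product of `X` (`pairingB_eq_inner`). Dropping `-ε_k
‖z_k‖²`, letting `k → ∞` and dividing by `ε_n` leaves `‖z_n‖² ≤ ⟨z_n, z₀⟩`, hence `‖z_n - z₀‖² ≤
‖z₀‖² - ⟨z_n, z₀⟩ → 0` (`tendsto_of_isRegularisedSolution`). No Minty argument is needed, and both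
equations pass to the limit directly.

The Hamilton-Jacobi equation with its `ε` term holds a.e. for each `z_n`, and continuity of `H`
carries it along an a.e. convergent subsequence. In the Fokker-Planck equation, (H3) gives `D_pH`
linear growth, so the drifts converge in `L²` by Vitali's theorem, while `m_n Dv → m Dv` in `L²` for
bounded `Dv` (`integral_integrandFP_eq_zero`). The test function `1` yields unit mass.

If the pairing converges in every direction, then `v ↦ ∫ m D_pH · Dv` is a bounded functional on
`H¹` by truncation and Banach-Steinhaus. The Fokker-Planck functional vanishes on smooth functions,
which are dense by Fourier analysis, so it vanishes everywhere
(`integral_integrandFP_eq_zero_of_smooth`). -/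

instance isProbabilityMeasure_torus (d : ℕ) :
    IsProbabilityMeasure (volume : Measure (Torus d)) := by
  have : IsProbabilityMeasure (volume : Measure UnitAddCircle) := ⟨UnitAddCircle.measure_univ⟩
  infer_instance

variable {d : ℕ}

/-! ### Components of elements of `X` -/

theorem X.memLp_m (z : X d) : MemLp z.m 2 volume := Lp.memLp z.fst

theorem X.memLp_u (z : X d) : MemLp z.u 2 volume := Lp.memLp z.snd.1.fst

theorem X.memLp_Du (z : X d) : MemLp z.Du 2 volume := Lp.memLp z.snd.1.snd

theorem X.continuous_fst (d : ℕ) : Continuous fun z : X d => z.fst :=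
  WithLp.continuous_fst 2 _ _

theorem X.continuous_snd_fst (d : ℕ) : Continuous fun z : X d => z.snd.1.fst :=
  (WithLp.continuous_fst 2 _ _).comp
    (continuous_subtype_val.comp (WithLp.continuous_snd 2 _ _))

theorem X.continuous_snd_snd (d : ℕ) : Continuous fun z : X d => z.snd.1.snd :=
  (WithLp.continuous_snd 2 _ _).comp
    (continuous_subtype_val.comp (WithLp.continuous_snd 2 _ _))

theorem X.m_sub (z w : X d) : (z - w).m =ᵐ[volume] fun x => z.m x - w.m x :=
  Lp.coeFn_sub z.fst w.fst

theorem X.u_sub (z w : X d) : (z - w).u =ᵐ[volume] fun x => z.u x - w.u x :=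
  Lp.coeFn_sub z.snd.1.fst w.snd.1.fst

theorem X.Du_sub (z w : X d) : (z - w).Du =ᵐ[volume] fun x => z.Du x - w.Du x :=
  Lp.coeFn_sub z.snd.1.snd w.snd.1.snd

theorem X.inner_eq (z w : X d) :
    inner ℝ z w = inner ℝ z.fst w.fst
      + (inner ℝ z.snd.1.fst w.snd.1.fst + inner ℝ z.snd.1.snd w.snd.1.snd) := by
  rw [WithLp.prod_inner_apply, Submodule.coe_inner, WithLp.prod_inner_apply]
  rfl

theorem L2.integral_mul (f g : L2 d) : ∫ x, f x * g x = inner ℝ f g := by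
  rw [L2.inner_def]
  exact integral_congr_ae (ae_of_all _ fun x => mul_comm _ _)

theorem pairingB_eq_inner (z w : X d) : pairingB z w = inner ℝ z w := by
  have h1 : Integrable (fun x => z.m x * w.m x) volume :=
    z.memLp_m.integrable_mul w.memLp_m
  have h2 : Integrable (fun x => z.u x * w.u x) volume :=
    z.memLp_u.integrable_mul w.memLp_u
  have h3 : Integrable (fun x => inner ℝ (z.Du x) (w.Du x)) volume :=
    L2.integrable_inner z.snd.1.snd w.snd.1.snd
  have h12 : Integrable (fun x => z.m x * w.m x + z.u x * w.u x) volume := h1.add h2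
  have e1 : ∫ x, z.m x * w.m x = inner ℝ z.fst w.fst := L2.integral_mul _ _
  have e2 : ∫ x, z.u x * w.u x = inner ℝ z.snd.1.fst w.snd.1.fst := L2.integral_mul _ _
  have e3 : ∫ x, inner ℝ (z.Du x) (w.Du x) = inner ℝ z.snd.1.snd w.snd.1.snd :=
    (L2.inner_def _ _).symm
  rw [pairingB, integral_add h12 h3, integral_add h1 h2, e1, e2, e3, X.inner_eq, add_assoc]

theorem WeaklyTendsto.tendsto_apply {E : Type*} [NormedAddCommGroup E] [NormedSpace ℝ E]
    {z : ℕ → E} {z₀ : E} (h : WeaklyTendsto z z₀) (f : StrongDual ℝ E) :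
    Tendsto (fun n => f (z n)) atTop (𝓝 (f z₀)) :=
  ((WeakBilin.eval_continuous (topDualPairing ℝ E).flip f).tendsto _).comp h

theorem tendsto_inner_of_weaklyTendsto {z : ℕ → X d} {z₀ : X d}
    (hm : WeaklyTendsto (fun n => (z n).fst) z₀.fst)
    (hu : WeaklyTendsto (fun n => (z n).snd) z₀.snd) (y : X d) :
    Tendsto (fun n => inner ℝ y (z n)) atTop (𝓝 (inner ℝ y z₀)) := by
  simp only [WithLp.prod_inner_apply]
  exact (hm.tendsto_apply (innerSL ℝ y.fst)).add (hu.tendsto_apply (innerSL ℝ y.snd))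

/-! ### Monotonicity and strong convergence of the regularised solutions -/

/-- In the difference `V` and the source `1` drop out, and the zero-order terms `-u μ` and `m v` are
skew, so they cancel. What remains is pointwise the expression in (H2). -/
theorem pairingA_monotone {H : Vec d → ℝ → ℝ} (hH : StructuralAssumptions H) {V : Torus d → ℝ}
    {z w : X d} (hz : ∀ᵐ x, 0 ≤ z.m x) (hw : ∀ᵐ x, 0 ≤ w.m x)
    (hzc : PairingConverges H V z (z - w)) (hwc : PairingConverges H V w (z - w)) :
    0 ≤ pairingA H V z (z - w) - pairingA H V w (z - w) := by
  have e : pairingA H V z (z - w) - pairingA H V w (z - w) =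
      ∫ x, ((integrandHJ H V z (z - w) x + integrandFP H z (z - w) x)
        - (integrandHJ H V w (z - w) x + integrandFP H w (z - w) x)) := by
    have h1 : Integrable (fun x => integrandHJ H V z (z - w) x + integrandFP H z (z - w) x) volume :=
      hzc.1.add hzc.2
    have h2 : Integrable (fun x => integrandHJ H V w (z - w) x + integrandFP H w (z - w) x) volume :=
      hwc.1.add hwc.2
    rw [integral_sub h1 h2, integral_add hzc.1 hzc.2,
      integral_add hwc.1 hwc.2]
    rfl
  rw [e]
  refine integral_nonneg_of_ae ?_
  filter_upwards [hz, hw, X.m_sub z w, X.u_sub z w, X.Du_sub z w] with x h1 h2 h3 h4 h5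
  have h := hH.monotone (z.Du x) (w.Du x) (z.m x) (w.m x) h1 h2
  rw [inner_sub_left, inner_smul_left, inner_smul_left] at h
  simp only [conj_trivial] at h
  simp only [Pi.zero_apply, integrandHJ, integrandFP, h3, h4, h5]
  linarith

theorem IsRegularisedSolution.inner_nonneg {H : Vec d → ℝ → ℝ} (hH : StructuralAssumptions H)
    {V : Torus d → ℝ} {a b : ℝ} {z w : X d} (hz : IsRegularisedSolution H V a z)
    (hw : IsRegularisedSolution H V b w) :
    0 ≤ b * inner ℝ w (z - w) - a * inner ℝ z (z - w) := by
  have h := pairingA_monotone hH hz.nonneg hw.nonneg (hz.converges (z - w)) (hw.converges (z - w))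
  have h1 := hz.eq_zero (z - w)
  have h2 := hw.eq_zero (z - w)
  rw [pairingB_eq_inner] at h1 h2
  linarith

/-- Comparing `z n` with `z k` and sending only `k` to infinity needs no bound on the norms: the one
term quadratic in `z k` has a favourable sign. -/
theorem tendsto_of_isRegularisedSolution {H : Vec d → ℝ → ℝ} (hH : StructuralAssumptions H)
    {V : Torus d → ℝ} {ε : ℕ → ℝ} (hε : ∀ n, 0 < ε n) (hε₀ : Tendsto ε atTop (𝓝 0))
    {z : ℕ → X d} (hz : ∀ n, IsRegularisedSolution H V (ε n) (z n)) {z₀ : X d}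
    (hw : ∀ y, Tendsto (fun n => inner ℝ y (z n)) atTop (𝓝 (inner ℝ y z₀))) :
    Tendsto z atTop (𝓝 z₀) := by
  have key : ∀ n, ‖z n‖ ^ 2 ≤ inner ℝ (z n) z₀ := by
    intro n
    have h1 : ∀ k, 0 ≤ ε k * inner ℝ (z n) (z k)
        - ε n * (inner ℝ (z n) (z n) - inner ℝ (z n) (z k)) := by
      intro k
      have h := (hz n).inner_nonneg hH (hz k)
      rw [inner_sub_right, inner_sub_right, real_inner_comm (z n) (z k)] at h
      have h' : 0 ≤ ε k * inner ℝ (z k) (z k) := mul_nonneg (hε k).le real_inner_self_nonneg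
      linarith
    -- With `n` fixed, every remaining term is linear in `z k`, so weak convergence suffices.
    have h2 : Tendsto (fun k => ε k * inner ℝ (z n) (z k)
        - ε n * (inner ℝ (z n) (z n) - inner ℝ (z n) (z k))) atTop
        (𝓝 (0 * inner ℝ (z n) z₀ - ε n * (inner ℝ (z n) (z n) - inner ℝ (z n) z₀))) :=
      (hε₀.mul (hw _)).sub ((tendsto_const_nhds.sub (hw _)).const_mul _)
    have h3 := ge_of_tendsto' h2 h1
    rw [real_inner_self_eq_norm_sq] at h3
    by_contra hc
    push Not at hc
    have := mul_pos (hε n) (sub_pos.2 hc)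
    linarith
  rw [tendsto_iff_norm_sub_tendsto_zero]
  have h4 : Tendsto (fun n => ‖z₀‖ ^ 2 - inner ℝ z₀ (z n)) atTop (𝓝 0) := by
    have := (tendsto_const_nhds (x := ‖z₀‖ ^ 2)).sub (hw z₀)
    rwa [real_inner_self_eq_norm_sq, sub_self] at this
  have h5 : Tendsto (fun n => ‖z n - z₀‖ ^ 2) atTop (𝓝 0) := by
    refine squeeze_zero (fun n => sq_nonneg _) (fun n => ?_) h4
    rw [norm_sub_sq_real, real_inner_comm z₀ (z n)]
    have := key n
    rw [real_inner_comm] at this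
    have h6 := real_inner_comm z₀ (z n)
    linarith
  have h6 := h5.sqrt
  simpa [Real.sqrt_sq] using h6

/-! ### Regularity of the Hamiltonian -/

theorem StructuralAssumptions.continuous_max {H : Vec d → ℝ → ℝ} (hH : StructuralAssumptions H) :
    Continuous (fun y : Vec d × ℝ => H y.1 (max y.2 0)) :=
  hH.contDiffOn.continuousOn.comp_continuous (f := fun y : Vec d × ℝ => (y.1, max y.2 0))
    (by fun_prop) (fun y => ⟨trivial, Set.mem_Ici.2 (le_max_right _ _)⟩)

/-- The slices `m = const ≥ 0` lie inside the half-space, so even at `m = 0` the full gradient in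
`p` is the within-derivative restricted to the `p`-directions. Composing with `max · 0` makes it
continuous on the whole space. -/
theorem StructuralAssumptions.continuous_gradP_max {H : Vec d → ℝ → ℝ}
    (hH : StructuralAssumptions H) :
    Continuous (fun y : Vec d × ℝ => gradP H y.1 (max y.2 0)) := by
  set F : Vec d × ℝ → ℝ := fun y => H y.1 y.2 with hF
  set S : Set (Vec d × ℝ) := Set.univ ×ˢ Set.Ici 0 with hS
  have hmem : ∀ y : Vec d × ℝ, ((y.1, max y.2 0) : Vec d × ℝ) ∈ S := fun y =>
    ⟨trivial, Set.mem_Ici.2 (le_max_right _ _)⟩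
  have h1 : ContinuousOn (fderivWithin ℝ F S) S :=
    hH.contDiffOn.continuousOn_fderivWithin (uniqueDiffOn_univ.prod (uniqueDiffOn_Ici 0)) (by simp)
  have h2 : Continuous (fun y : Vec d × ℝ => fderivWithin ℝ F S (y.1, max y.2 0)) :=
    h1.comp_continuous (f := fun y : Vec d × ℝ => (y.1, max y.2 0)) (by fun_prop) hmem
  have h3 : ∀ y : Vec d × ℝ, gradP H y.1 (max y.2 0) = (InnerProductSpace.toDual ℝ (Vec d)).symm
      ((fderivWithin ℝ F S (y.1, max y.2 0)).comp (ContinuousLinearMap.inl ℝ (Vec d) ℝ)) := by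
    intro y
    have h4 : HasFDerivWithinAt F (fderivWithin ℝ F S (y.1, max y.2 0)) S (y.1, max y.2 0) :=
      ((hH.contDiffOn.differentiableOn one_ne_zero) _ (hmem y)).hasFDerivWithinAt
    have h5 : HasFDerivWithinAt (fun q : Vec d => ((q, max y.2 0) : Vec d × ℝ))
        (ContinuousLinearMap.inl ℝ (Vec d) ℝ) Set.univ y.1 :=
      (hasFDerivAt_prodMk_left y.1 (max y.2 0)).hasFDerivWithinAt
    have h6 := h4.comp y.1 h5 (fun q _ => hmem (q, y.2))
    rw [hasFDerivWithinAt_univ] at h6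
    rw [gradP, gradient, ← h6.fderiv]
    rfl
  simp only [h3]
  exact (LinearIsometryEquiv.continuous _).comp (h2.clm_comp continuous_const)

theorem StructuralAssumptions.exists_gradP_bound {H : Vec d → ℝ → ℝ}
    (hH : StructuralAssumptions H) :
    ∃ c : ℝ, ∀ (p : Vec d) (m : ℝ), 0 ≤ m → ‖gradP H p m‖ ≤ c * (1 + ‖p‖ + |m|) := by
  obtain ⟨C, hC, h⟩ := hH.growth
  -- The growth bound is quadratic for the square of the gradient, and `1 + ‖p‖² + m² ≤ (1 + ‖p‖ +
  -- m)²`.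
  refine ⟨√C, fun p m hm => ?_⟩
  rw [abs_of_nonneg hm]
  refine abs_le_of_sq_le_sq' ?_ (by positivity) |>.2
  rw [mul_pow, Real.sq_sqrt hC.le]
  have h1 := h p m hm
  have h2 : C * (1 + ‖p‖ ^ 2 + m ^ 2) ≤ C * (1 + ‖p‖ + m) ^ 2 := by
    refine mul_le_mul_of_nonneg_left ?_ hC.le
    nlinarith [norm_nonneg p, mul_nonneg (norm_nonneg p) hm]
  linarith [abs_nonneg (H p m)]

/-- The field `D_pH(Du,m)`. -/
def driftField (H : Vec d → ℝ → ℝ) (z : X d) (x : Torus d) : Vec d := gradP H (z.Du x) (z.m x)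

theorem memLp_driftField {H : Vec d → ℝ → ℝ} (hH : StructuralAssumptions H) {z : X d}
    (hz : ∀ᵐ x, 0 ≤ z.m x) : MemLp (driftField H z) 2 volume := by
  obtain ⟨c, hc⟩ := hH.exists_gradP_bound
  have hmeas : AEStronglyMeasurable (driftField H z) volume := by
    have h0 : AEStronglyMeasurable (fun x => (z.Du x, z.m x)) volume :=
      z.memLp_Du.aestronglyMeasurable.prodMk z.memLp_m.aestronglyMeasurable
    have h1 : AEStronglyMeasurable (fun x => gradP H (z.Du x) (max (z.m x) 0)) volume :=
      hH.continuous_gradP_max.comp_aestronglyMeasurable h0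
    refine h1.congr ?_
    filter_upwards [hz] with x hx
    simp [driftField, max_eq_left hx]
  have hb0 : MemLp (fun x => 1 + ‖z.Du x‖ + |z.m x|) 2 volume :=
    ((memLp_const (1 : ℝ)).add z.memLp_Du.norm).add z.memLp_m.norm
  have hb : MemLp (fun x => c * (1 + ‖z.Du x‖ + |z.m x|)) 2 volume := hb0.const_mul c
  refine hb.mono hmeas ?_
  filter_upwards [hz] with x hx
  rw [Real.norm_eq_abs]
  exact (hc (z.Du x) (z.m x) hx).trans (le_abs_self _)

theorem memLp_smul_of_top {f : Torus d → ℝ} {g : Torus d → Vec d} (hf : MemLp f 2 volume)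
    (hg : MemLp g ⊤ volume) : MemLp (fun x => f x • g x) 2 volume :=
  MemLp.smul (p := 2) (q := ⊤) hg hf

theorem integrable_smul_driftField {H : Vec d → ℝ → ℝ} (hH : StructuralAssumptions H) {z : X d}
    (hz : ∀ᵐ x, 0 ≤ z.m x) : Integrable (fun x => z.m x • driftField H z x) volume :=
  memLp_one_iff_integrable.1 (MemLp.smul (p := 2) (q := 2) (memLp_driftField hH hz) z.memLp_m)

theorem integrable_FP_lower (z w : X d) : Integrable (fun x => (z.m x - 1) * w.u x) volume :=
  (z.memLp_m.sub (memLp_const 1)).integrable_mul w.memLp_u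

theorem integrandFP_eq (H : Vec d → ℝ → ℝ) (z w : X d) (x : Torus d) :
    integrandFP H z w x =
      inner ℝ (driftField H z x) (z.m x • w.Du x) + (z.m x - 1) * w.u x := by
  rw [integrandFP, inner_smul_right, driftField]

theorem integrable_integrandFP {H : Vec d → ℝ → ℝ} (hH : StructuralAssumptions H) {z w : X d}
    (hz : ∀ᵐ x, 0 ≤ z.m x) (hw : MemLp w.Du ⊤ volume) :
    Integrable (integrandFP H z w) volume := by
  have h1 := L2.integrable_inner (𝕜 := ℝ) (memLp_driftField hH hz).toLp
    (memLp_smul_of_top z.memLp_m hw).toLp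
  refine Integrable.congr (h1.add (integrable_FP_lower z w)) ?_
  filter_upwards [(memLp_driftField hH hz).coeFn_toLp,
    (memLp_smul_of_top z.memLp_m hw).coeFn_toLp] with x e1 e2
  rw [integrandFP_eq, Pi.add_apply, e1, e2]

theorem integral_integrandFP {H : Vec d → ℝ → ℝ} (hH : StructuralAssumptions H) {z w : X d}
    (hz : ∀ᵐ x, 0 ≤ z.m x) (hw : MemLp w.Du ⊤ volume) :
    ∫ x, integrandFP H z w x = inner ℝ (memLp_driftField hH hz).toLp
        (memLp_smul_of_top z.memLp_m hw).toLp
      + (inner ℝ z.fst w.snd.1.fst - ∫ x, w.u x) := by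
  have h1 := L2.integrable_inner (𝕜 := ℝ) (memLp_driftField hH hz).toLp
    (memLp_smul_of_top z.memLp_m hw).toLp
  have h2 : Integrable (fun x => z.m x * w.u x) volume := z.memLp_m.integrable_mul w.memLp_u
  have h3 : Integrable (fun x => w.u x) volume := w.memLp_u.integrable one_le_two
  have e : inner ℝ z.fst w.snd.1.fst = ∫ x, z.m x * w.u x := (L2.integral_mul _ _).symm
  have h23 : Integrable (fun x => z.m x * w.u x - w.u x) volume := h2.sub h3
  rw [e, L2.inner_def, ← integral_sub h2 h3, ← integral_add h1 h23]
  refine integral_congr_ae ?_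
  filter_upwards [(memLp_driftField hH hz).coeFn_toLp,
    (memLp_smul_of_top z.memLp_m hw).coeFn_toLp] with x e1 e2
  rw [integrandFP_eq, e1, e2]
  ring

/-! ### The pointwise Hamilton-Jacobi equation -/

theorem IsRegularisedSolution.hamiltonJacobi {H : Vec d → ℝ → ℝ} {V : Torus d → ℝ} {ε : ℝ}
    {z : X d} (hz : IsRegularisedSolution H V ε z) :
    ∀ᵐ x, -z.u x - H (z.Du x) (z.m x) - V x + ε * z.m x = 0 := by
  -- The directions `(1_s, 0)` isolate the first equation and localise it to `s`.
  have dir : ∀ {s : Set (Torus d)} (hs : MeasurableSet s),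
      ∃ w : X d, w.m =ᵐ[volume] s.indicator (fun _ => (1 : ℝ)) ∧ w.u =ᵐ[volume] 0 ∧
        w.Du =ᵐ[volume] 0 := fun {s} hs =>
    ⟨WithLp.toLp 2 (indicatorConstLp 2 hs (measure_ne_top _ _) (1 : ℝ), 0),
      indicatorConstLp_coeFn (hs := hs) (hμs := measure_ne_top _ _),
      Lp.coeFn_zero _ _ _, Lp.coeFn_zero _ _ _⟩
  have hm : Integrable z.m volume := z.memLp_m.integrable one_le_two
  -- The direction `(1, 0)` turns convergence of the pairing into integrability of the residual
  -- itself.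
  have hint : Integrable (fun x => -z.u x - H (z.Du x) (z.m x) - V x) volume := by
    obtain ⟨w, h1, -, -⟩ := dir MeasurableSet.univ
    refine (hz.converges w).1.congr ?_
    filter_upwards [h1] with x e1
    simp [integrandHJ, e1]
  refine Integrable.ae_eq_zero_of_forall_setIntegral_eq_zero (hint.add (hm.const_mul ε)) ?_
  intro s hs _
  obtain ⟨w, h1, h2, h3⟩ := dir hs
  have h := hz.eq_zero w
  have e1 : ∫ x, integrandHJ H V z w x = ∫ x in s, (-z.u x - H (z.Du x) (z.m x) - V x) := by
    rw [← integral_indicator hs]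
    refine integral_congr_ae ?_
    filter_upwards [h1] with x e1
    by_cases hx : x ∈ s <;> simp [integrandHJ, e1, hx]
  have e2 : ∫ x, integrandFP H z w x = 0 := by
    refine integral_eq_zero_of_ae ?_
    filter_upwards [h2, h3] with x e2 e3
    simp [integrandFP, e2, e3]
  have e3 : pairingB z w = ∫ x in s, z.m x := by
    rw [← integral_indicator hs]
    refine integral_congr_ae ?_
    filter_upwards [h1, h2, h3] with x e1 e2 e3
    by_cases hx : x ∈ s <;> simp [e1, e2, e3, hx]
  rw [pairingA, e1, e2, e3] at h
  have e4 := integral_add (μ := volume.restrict s) hint.integrableOn (hm.const_mul ε).integrableOn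
  rw [integral_const_mul] at e4
  exact e4.trans (by linarith)

theorem exists_subseq_tendsto_ae {z : ℕ → X d} {z₀ : X d} (h : Tendsto z atTop (𝓝 z₀)) :
    ∃ ns : ℕ → ℕ, StrictMono ns ∧ ∀ᵐ x,
      Tendsto (fun k => (z (ns k)).m x) atTop (𝓝 (z₀.m x)) ∧
      Tendsto (fun k => (z (ns k)).u x) atTop (𝓝 (z₀.u x)) ∧
      Tendsto (fun k => (z (ns k)).Du x) atTop (𝓝 (z₀.Du x)) := by
  have hm : Tendsto (fun n => (z n).fst) atTop (𝓝 z₀.fst) :=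
    ((X.continuous_fst d).tendsto _).comp h
  have hu : Tendsto (fun n => (z n).snd.1.fst) atTop (𝓝 z₀.snd.1.fst) :=
    ((X.continuous_snd_fst d).tendsto _).comp h
  have hDu : Tendsto (fun n => (z n).snd.1.snd) atTop (𝓝 z₀.snd.1.snd) :=
    ((X.continuous_snd_snd d).tendsto _).comp h
  obtain ⟨n₁, i₁, h₁⟩ := (tendstoInMeasure_of_tendsto_Lp hm).exists_seq_tendsto_ae
  obtain ⟨n₂, i₂, h₂⟩ :=
    (tendstoInMeasure_of_tendsto_Lp (hu.comp i₁.tendsto_atTop)).exists_seq_tendsto_ae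
  obtain ⟨n₃, i₃, h₃⟩ := (tendstoInMeasure_of_tendsto_Lp
    (hDu.comp (i₁.comp i₂).tendsto_atTop)).exists_seq_tendsto_ae
  refine ⟨n₁ ∘ n₂ ∘ n₃, i₁.comp (i₂.comp i₃), ?_⟩
  filter_upwards [h₁, h₂, h₃] with x t₁ t₂ t₃
  exact ⟨t₁.comp (i₂.comp i₃).tendsto_atTop, t₂.comp i₃.tendsto_atTop, t₃⟩

theorem nonneg_of_tendsto {z : ℕ → X d} {z₀ : X d} (h : Tendsto z atTop (𝓝 z₀))
    (hz : ∀ n, ∀ᵐ x, 0 ≤ (z n).m x) : ∀ᵐ x, 0 ≤ z₀.m x := by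
  obtain ⟨ns, -, hae⟩ := exists_subseq_tendsto_ae h
  filter_upwards [hae, ae_all_iff.2 hz] with x hx h0
  exact ge_of_tendsto' hx.1 fun k => h0 (ns k)

theorem hamiltonJacobi_of_tendsto {H : Vec d → ℝ → ℝ} (hH : StructuralAssumptions H)
    {V : Torus d → ℝ} {ε : ℕ → ℝ} (hε₀ : Tendsto ε atTop (𝓝 0)) {z : ℕ → X d} {z₀ : X d}
    (h : Tendsto z atTop (𝓝 z₀)) (hz : ∀ n, IsRegularisedSolution H V (ε n) (z n)) :
    ∀ᵐ x, -z₀.u x - H (z₀.Du x) (z₀.m x) - V x = 0 := by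
  obtain ⟨ns, hns, hae⟩ := exists_subseq_tendsto_ae h
  filter_upwards [hae, ae_all_iff.2 fun n => (hz n).nonneg,
    ae_all_iff.2 fun n => (hz n).hamiltonJacobi,
    nonneg_of_tendsto h fun n => (hz n).nonneg] with x ⟨hm, hu, hDu⟩ h0 hHJ h0'
  have hlim := (hH.continuous_max.tendsto (z₀.Du x, z₀.m x)).comp (hDu.prodMk_nhds hm)
  have hlim2 := ((hu.neg.sub hlim).sub_const (V x)).add
    ((hε₀.comp hns.tendsto_atTop).mul hm)
  simp only [Function.comp_apply, max_eq_left (h0 _), hHJ, max_eq_left h0', zero_mul, add_zero]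
    at hlim2
  exact (tendsto_nhds_unique hlim2 tendsto_const_nhds)

/-! ### Passage to the limit in the Fokker-Planck equation -/

theorem UnifIntegrable.mono {α β γ ι : Type*} [MeasurableSpace α] {μ : Measure α}
    [NormedAddCommGroup β] [NormedAddCommGroup γ] {p : ENNReal} {f : ι → α → β} {g : ι → α → γ}
    (hg : UnifIntegrable g p μ) (h : ∀ n, ∀ᵐ x ∂μ, ‖f n x‖ ≤ ‖g n x‖) :
    UnifIntegrable f p μ := by
  intro ε hε
  obtain ⟨δ, hδ, H⟩ := hg hε
  refine ⟨δ, hδ, fun n s hs hμ => (eLpNorm_mono_ae ?_).trans (H n s hs hμ)⟩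
  filter_upwards [h n] with x hx
  by_cases hxs : x ∈ s <;> simp [hxs, hx]

/-- The drifts are dominated by `c (1 + ‖Du_n‖ + |m_n|)`, whose summands converge strongly in `L²`
and are therefore uniformly integrable. -/
theorem unifIntegrable_driftField {H : Vec d → ℝ → ℝ} (hH : StructuralAssumptions H)
    {z : ℕ → X d} {z₀ : X d} (h : Tendsto z atTop (𝓝 z₀))
    (hz : ∀ n, ∀ᵐ x, 0 ≤ (z n).m x) :
    UnifIntegrable (fun n => driftField H (z n)) 2 (volume : Measure (Torus d)) := by
  obtain ⟨c, hc⟩ := hH.exists_gradP_bound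
  have aux : ∀ {F : Type} [NormedAddCommGroup F] [NormedSpace ℝ F]
      {a : ℕ → Lp F 2 (volume : Measure (Torus d))} {a₀ : Lp F 2 (volume : Measure (Torus d))},
      Tendsto a atTop (𝓝 a₀) →
      UnifIntegrable (fun n x => ‖c • a n x‖) 2 (volume : Measure (Torus d)) := by
    intro F _ _ a a₀ ha
    have h1 : UnifIntegrable (fun n => (c • a n : Lp F 2 (volume : Measure (Torus d)))) 2
        (volume : Measure (Torus d)) :=
      unifIntegrable_of_tendsto_Lp one_le_two (by simp) (fun n => Lp.memLp _) (Lp.memLp (c • a₀))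
        ((Lp.tendsto_Lp_iff_tendsto_eLpNorm' _ _).1 (ha.const_smul c))
    refine UnifIntegrable.mono h1 fun n => ?_
    filter_upwards [Lp.coeFn_smul c (a n)] with x hx
    simp [hx]
  have hm : Tendsto (fun n => (z n).fst) atTop (𝓝 z₀.fst) :=
    ((X.continuous_fst d).tendsto _).comp h
  have hDu : Tendsto (fun n => (z n).snd.1.snd) atTop (𝓝 z₀.snd.1.snd) :=
    ((X.continuous_snd_snd d).tendsto _).comp h
  have u1 : UnifIntegrable (fun (_ : ℕ) (_ : Torus d) => c) 2 volume :=
    unifIntegrable_const one_le_two (by simp) (memLp_const c)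
  have u2 := aux hDu
  have u3 := aux hm
  have hc0 : 0 ≤ c := by
    have := (norm_nonneg _).trans (hc 0 0 le_rfl)
    simpa using this
  refine UnifIntegrable.mono ((u1.add u2 one_le_two (fun _ => aestronglyMeasurable_const)
    (fun n => ((Lp.aestronglyMeasurable _).const_smul c).norm)).add u3 one_le_two
    (fun n => aestronglyMeasurable_const.add ((Lp.aestronglyMeasurable _).const_smul c).norm)
    (fun n => ((Lp.aestronglyMeasurable _).const_smul c).norm)) fun n => ?_
  filter_upwards [hz n] with x hx
  refine (hc _ _ hx).trans (le_trans (le_of_eq ?_) (le_abs_self _))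
  simp only [Pi.add_apply, norm_smul, Real.norm_eq_abs, abs_of_nonneg hc0, X.Du, X.m]
  ring

/-- Vitali's theorem: a.e. convergence from continuity of `D_pH`, together with uniform
integrability. -/
theorem tendsto_toLp_driftField {H : Vec d → ℝ → ℝ} (hH : StructuralAssumptions H)
    {z : ℕ → X d} {z₀ : X d} (h : Tendsto z atTop (𝓝 z₀))
    (hz : ∀ n, ∀ᵐ x, 0 ≤ (z n).m x) (hz₀ : ∀ᵐ x, 0 ≤ z₀.m x)
    (hae : ∀ᵐ x, Tendsto (fun k => (z k).m x) atTop (𝓝 (z₀.m x)) ∧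
      Tendsto (fun k => (z k).Du x) atTop (𝓝 (z₀.Du x))) :
    Tendsto (fun n => (memLp_driftField hH (hz n)).toLp) atTop
      (𝓝 (memLp_driftField hH hz₀).toLp) := by
  refine (Lp.tendsto_Lp_iff_tendsto_eLpNorm'' _ _ _ _).2 ?_
  refine tendsto_Lp_finite_of_tendsto_ae one_le_two (by simp)
    (fun n => (memLp_driftField hH (hz n)).aestronglyMeasurable) (memLp_driftField hH hz₀)
    (unifIntegrable_driftField hH h hz) ?_
  filter_upwards [hae, ae_all_iff.2 hz, hz₀] with x ⟨hm, hDu⟩ h0 h0'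
  have hlim := (hH.continuous_gradP_max.tendsto (z₀.Du x, z₀.m x)).comp (hDu.prodMk_nhds hm)
  simpa only [Function.comp_def, max_eq_left (h0 _), max_eq_left h0', driftField] using hlim

theorem tendsto_toLp_smul_of_top {z : ℕ → X d} {z₀ : X d} (h : Tendsto z atTop (𝓝 z₀))
    {g : Torus d → Vec d} (hg : MemLp g ⊤ volume) :
    Tendsto (fun n => (memLp_smul_of_top (z n).memLp_m hg).toLp) atTop
      (𝓝 (memLp_smul_of_top z₀.memLp_m hg).toLp) := by
  refine (Lp.tendsto_Lp_iff_tendsto_eLpNorm'' _ _ _ _).2 ?_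
  have hm : Tendsto (fun n => (z n).fst) atTop (𝓝 z₀.fst) :=
    ((X.continuous_fst d).tendsto _).comp h
  have hm' := (Lp.tendsto_Lp_iff_tendsto_eLpNorm' _ _).1 hm
  have hgb := ae_le_eLpNormEssSup (f := g) (μ := volume)
  have hfin : eLpNormEssSup g volume ≠ ⊤ := by
    have := hg.2.ne
    rwa [eLpNorm_exponent_top] at this
  have hlim : Tendsto (fun n => ENNReal.ofReal (eLpNormEssSup g volume).toReal
      * eLpNorm ((z n).fst - z₀.fst : Torus d → ℝ) 2 volume) atTop (𝓝 0) := by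
    have := ENNReal.Tendsto.const_mul hm'
      (Or.inr (ENNReal.ofReal_ne_top (r := (eLpNormEssSup g volume).toReal)))
    rwa [mul_zero] at this
  refine tendsto_of_tendsto_of_tendsto_of_le_of_le tendsto_const_nhds hlim
    (fun n => zero_le) fun n => ?_
  refine eLpNorm_le_mul_eLpNorm_of_ae_le_mul ?_ 2
  filter_upwards [hgb] with x hx
  have hx' : ‖g x‖ ≤ (eLpNormEssSup g volume).toReal := by
    rw [← toReal_enorm]
    exact ENNReal.toReal_mono hfin hx
  have e : (z n).m x • g x - z₀.m x • g x = ((z n).m x - z₀.m x) • g x := (sub_smul _ _ _).symm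
  simp only [Pi.sub_apply]
  rw [e, norm_smul, mul_comm]
  exact mul_le_mul_of_nonneg_right hx' (norm_nonneg _)

/-- For bounded `Dv` the flux term is the `L²` pairing of `D_pH` with `m Dv`. Both factors converge
strongly, so the pairings converge. -/
theorem integral_integrandFP_eq_zero {H : Vec d → ℝ → ℝ} (hH : StructuralAssumptions H)
    {V : Torus d → ℝ} {ε : ℕ → ℝ} (hε₀ : Tendsto ε atTop (𝓝 0)) {z : ℕ → X d} {z₀ : X d}
    (h : Tendsto z atTop (𝓝 z₀)) (hz : ∀ n, IsRegularisedSolution H V (ε n) (z n))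
    {w : X d} (hw : MemLp w.Du ⊤ volume) : ∫ x, integrandFP H z₀ w x = 0 := by
  obtain ⟨ns, hns, hae⟩ := exists_subseq_tendsto_ae h
  have hn := fun n => (hz n).nonneg
  have h' : Tendsto (fun k => z (ns k)) atTop (𝓝 z₀) := h.comp hns.tendsto_atTop
  have hm : Tendsto (fun k => (z (ns k)).fst) atTop (𝓝 z₀.fst) :=
    ((X.continuous_fst d).tendsto _).comp h'
  have hz₀ := nonneg_of_tendsto h hn
  have l1 : Tendsto (fun k => ∫ x, integrandFP H (z (ns k)) w x) atTop
      (𝓝 (∫ x, integrandFP H z₀ w x)) := by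
    rw [integral_integrandFP hH hz₀ hw]
    simp only [fun k => integral_integrandFP hH (hn (ns k)) hw]
    refine ((tendsto_toLp_driftField hH h' (fun k => hn (ns k)) hz₀
      (hae.mono fun x hx => ⟨hx.1, hx.2.2⟩)).inner (tendsto_toLp_smul_of_top h' hw)).add ?_
    exact (hm.inner tendsto_const_nhds).sub tendsto_const_nhds
  -- The Fokker-Planck integrand ignores the first component of `w`, so `w` may be replaced by `(0,
  -- v)`, which kills the Hamilton-Jacobi integral.
  have l2 : ∀ k, ∫ x, integrandFP H (z (ns k)) w x
      = -(ε (ns k) * inner ℝ (z (ns k)) (WithLp.toLp 2 (0, w.snd) : X d)) := by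
    intro k
    have h1 := (hz (ns k)).eq_zero (WithLp.toLp 2 (0, w.snd))
    have h2 : ∫ x, integrandHJ H V (z (ns k)) (WithLp.toLp 2 (0, w.snd)) x = 0 := by
      refine integral_eq_zero_of_ae ?_
      filter_upwards [Lp.coeFn_zero ℝ 2 (volume : Measure (Torus d))] with x hx
      have : X.m (WithLp.toLp 2 (0, w.snd) : X d) x = 0 := hx
      simp [integrandHJ, this]
    rw [pairingB_eq_inner, pairingA, h2, zero_add] at h1
    exact eq_neg_of_add_eq_zero_left h1
  have l3 : Tendsto (fun k => ∫ x, integrandFP H (z (ns k)) w x) atTop (𝓝 0) := by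
    simp only [l2]
    have := ((hε₀.comp hns.tendsto_atTop).mul
      (h'.inner (tendsto_const_nhds (x := (WithLp.toLp 2 (0, w.snd) : X d))))).neg
    simpa using this
  exact tendsto_nhds_unique l1 l3

/-! ### Calculus of smooth functions on the torus -/

theorem SmoothOnTorus.mul {φ ψ : Torus d → ℝ} (hφ : SmoothOnTorus φ) (hψ : SmoothOnTorus ψ) :
    SmoothOnTorus (fun x => φ x * ψ x) :=
  ContDiff.mul hφ hψ

theorem SmoothOnTorus.partialDeriv {φ : Torus d → ℝ} (hφ : SmoothOnTorus φ) (i : Fin d) :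
    SmoothOnTorus (partialDeriv φ i) := by
  unfold SmoothOnTorus
  simp only [fun y => hφ.partialDeriv_proj i y]
  exact (ContDiff.fderiv_right (m := (⊤ : ℕ∞)) hφ (by simp)).clm_apply contDiff_const

theorem SmoothOnTorus.hasDerivAt {φ : Torus d → ℝ} (hφ : SmoothOnTorus φ) (i : Fin d)
    (x : Torus d) (t : ℝ) :
    HasDerivAt (fun s : ℝ => φ (x + Pi.single i (s : UnitAddCircle)))
      (MFG.partialDeriv φ i (x + Pi.single i (t : UnitAddCircle))) t := by
  have h0 : ∀ x : Torus d, HasDerivAt (fun s : ℝ => φ (x + Pi.single i (s : UnitAddCircle)))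
      (MFG.partialDeriv φ i x) 0 := by
    intro x
    obtain ⟨y, rfl⟩ := (isOpenQuotientMap_proj d).surjective x
    refine DifferentiableAt.hasDerivAt ?_
    have h1 : ∀ t : ℝ, proj d y + Pi.single i (t : UnitAddCircle)
        = proj d (y + t • Pi.single i (1 : ℝ)) := by
      intro t
      funext j
      by_cases hj : j = i
      · subst hj; simp [proj]
      · simp [proj, hj]
    simp only [h1]
    exact ((ContDiff.differentiable hφ (by simp)).comp (by fun_prop :
      Differentiable ℝ fun t : ℝ => y + t • (Pi.single i (1 : ℝ) : Fin d → ℝ))) 0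
  have h2 : HasDerivAt (fun s : ℝ => φ (x + Pi.single i (t : UnitAddCircle)
      + Pi.single i ((s - t : ℝ) : UnitAddCircle)))
      (MFG.partialDeriv φ i (x + Pi.single i (t : UnitAddCircle))) t :=
    HasDerivAt.comp_sub_const (f := fun s : ℝ => φ (x + Pi.single i (t : UnitAddCircle)
      + Pi.single i (s : UnitAddCircle))) t t (by rw [sub_self]; exact h0 _)
  refine h2.congr_of_eventuallyEq (Eventually.of_forall fun s => ?_)
  simp only
  rw [add_assoc, ← Pi.single_add, ← AddCircle.coe_add]
  congr 4
  ring

/-- By translation invariance `t ↦ ∫ φ(x + t eᵢ)` is constant; differentiate under the integral at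
`t = 0`. -/
theorem SmoothOnTorus.integral_partialDeriv {φ : Torus d → ℝ} (hφ : SmoothOnTorus φ)
    (i : Fin d) : ∫ x, MFG.partialDeriv φ i x = 0 := by
  have hc := hφ.continuous_partialDeriv i
  obtain ⟨C, hC⟩ := isCompact_univ.exists_bound_of_continuousOn hc.continuousOn
  have hcφ := hφ.continuous
  have hint : ∀ f : Torus d → ℝ, Continuous f → Integrable f volume := fun f hf =>
    hf.integrable_of_hasCompactSupport (HasCompactSupport.of_compactSpace f)
  have hsh : ∀ (f : Torus d → ℝ), Continuous f → ∀ t : ℝ,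
      Continuous fun x : Torus d => f (x + Pi.single i (t : UnitAddCircle)) := fun f hf t =>
    hf.comp (continuous_id.add continuous_const)
  have m1 : ∀ᶠ t : ℝ in 𝓝 0, AEStronglyMeasurable
      (fun x : Torus d => φ (x + Pi.single i (t : UnitAddCircle))) volume :=
    Eventually.of_forall fun t => (hsh φ hcφ t).aestronglyMeasurable
  have m2 : AEStronglyMeasurable (fun x : Torus d =>
      MFG.partialDeriv φ i (x + Pi.single i ((0 : ℝ) : UnitAddCircle))) volume :=
    (hsh _ hc 0).aestronglyMeasurable
  have m3 : Integrable (fun x : Torus d => φ (x + Pi.single i ((0 : ℝ) : UnitAddCircle))) volume :=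
    hint _ (hsh φ hcφ 0)
  have m4 : ∀ᵐ x : Torus d, ∀ t ∈ (Set.univ : Set ℝ),
      ‖MFG.partialDeriv φ i (x + Pi.single i (t : UnitAddCircle))‖ ≤ C :=
    ae_of_all _ fun x t _ => hC _ trivial
  have m5 : ∀ᵐ x : Torus d, ∀ t ∈ (Set.univ : Set ℝ),
      HasDerivAt (fun s : ℝ => φ (x + Pi.single i (s : UnitAddCircle)))
        (MFG.partialDeriv φ i (x + Pi.single i (t : UnitAddCircle))) t :=
    ae_of_all _ fun x t _ => hφ.hasDerivAt i x t
  have h := (hasDerivAt_integral_of_dominated_loc_of_deriv_le univ_mem m1 m3 m2 m4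
    (integrable_const C) m5).2
  have e : ∀ t : ℝ, ∫ x : Torus d, φ (x + Pi.single i (t : UnitAddCircle)) = ∫ x, φ x := fun t =>
    integral_add_right_eq_self φ _
  simp only [e] at h
  have h0 := h.unique (hasDerivAt_const _ _)
  simpa using h0

theorem SmoothOnTorus.partialDeriv_mul {φ ψ : Torus d → ℝ} (hφ : SmoothOnTorus φ)
    (hψ : SmoothOnTorus ψ) (i : Fin d) (x : Torus d) :
    MFG.partialDeriv (fun x => φ x * ψ x) i x =
      MFG.partialDeriv φ i x * ψ x + φ x * MFG.partialDeriv ψ i x := by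
  have h := ((hφ.hasDerivAt i x 0).mul (hψ.hasDerivAt i x 0)).deriv
  rw [AddCircle.coe_zero, Pi.single_zero, add_zero] at h
  exact h

theorem memLp_of_continuous {E : Type*} [NormedAddCommGroup E] [SecondCountableTopology E]
    {f : Torus d → E} (hf : Continuous f) (p : ENNReal) : MemLp f p volume := by
  obtain ⟨C, hC⟩ := isCompact_univ.exists_bound_of_continuousOn hf.continuousOn
  exact MemLp.of_bound hf.aestronglyMeasurable C (ae_of_all _ fun x => hC x trivial)

theorem SmoothOnTorus.continuous_torusGrad {φ : Torus d → ℝ} (hφ : SmoothOnTorus φ) :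
    Continuous (torusGrad φ) :=
  (PiLp.continuous_toLp 2 _).comp (continuous_pi fun i => hφ.continuous_partialDeriv i)

/-- A smooth function as an element of `H¹`. -/
def SmoothOnTorus.toH1 {φ : Torus d → ℝ} (hφ : SmoothOnTorus φ) : H1 d :=
  ⟨WithLp.toLp 2 ((memLp_of_continuous hφ.continuous 2).toLp _,
    (memLp_of_continuous hφ.continuous_torusGrad 2).toLp _), by
    intro ψ hψ i
    have e1 : ∫ x, (memLp_of_continuous hφ.continuous 2).toLp _ x * MFG.partialDeriv ψ i x
        = ∫ x, φ x * MFG.partialDeriv ψ i x := by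
      refine integral_congr_ae ?_
      filter_upwards [(memLp_of_continuous hφ.continuous 2).coeFn_toLp] with x hx
      rw [hx]
    have e2 : ∫ x, (memLp_of_continuous hφ.continuous_torusGrad 2).toLp _ x i * ψ x
        = ∫ x, MFG.partialDeriv φ i x * ψ x := by
      refine integral_congr_ae ?_
      filter_upwards [(memLp_of_continuous hφ.continuous_torusGrad 2).coeFn_toLp] with x hx
      rw [hx]
      rfl
    change ∫ x, (memLp_of_continuous hφ.continuous 2).toLp _ x * MFG.partialDeriv ψ i x
      = -∫ x, (memLp_of_continuous hφ.continuous_torusGrad 2).toLp _ x i * ψ x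
    -- Integration by parts: the derivative of the product has zero integral.
    have h := (hφ.mul hψ).integral_partialDeriv i
    simp only [hφ.partialDeriv_mul hψ] at h
    have hint : ∀ f : Torus d → ℝ, Continuous f → Integrable f volume := fun f hf =>
      hf.integrable_of_hasCompactSupport (HasCompactSupport.of_compactSpace f)
    have h1 : Integrable (fun x => MFG.partialDeriv φ i x * ψ x) volume :=
      hint _ ((hφ.continuous_partialDeriv i).mul hψ.continuous)
    have h2 : Integrable (fun x => φ x * MFG.partialDeriv ψ i x) volume :=
      hint _ (hφ.continuous.mul (hψ.continuous_partialDeriv i))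
    rw [integral_add h1 h2] at h
    rw [e1, e2]
    linarith⟩

/-- The direction `(0, φ) ∈ X` for a smooth `φ`. -/
def SmoothOnTorus.toX {φ : Torus d → ℝ} (hφ : SmoothOnTorus φ) : X d :=
  WithLp.toLp 2 (0, hφ.toH1)

theorem SmoothOnTorus.toX_u {φ : Torus d → ℝ} (hφ : SmoothOnTorus φ) :
    hφ.toX.u =ᵐ[volume] φ :=
  (memLp_of_continuous hφ.continuous 2).coeFn_toLp

theorem SmoothOnTorus.toX_Du {φ : Torus d → ℝ} (hφ : SmoothOnTorus φ) :
    hφ.toX.Du =ᵐ[volume] torusGrad φ :=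
  (memLp_of_continuous hφ.continuous_torusGrad 2).coeFn_toLp

theorem SmoothOnTorus.memLp_toX_Du {φ : Torus d → ℝ} (hφ : SmoothOnTorus φ) :
    MemLp hφ.toX.Du ⊤ volume :=
  (memLp_of_continuous hφ.continuous_torusGrad ⊤).ae_eq hφ.toX_Du.symm

/-! ### Trigonometric functions -/

/-- The real trigonometric monomial `Re (c e^{2πi n·x})`. -/
def trigMonomial (n : Fin d → ℤ) (c : ℂ) (x : Torus d) : ℝ :=
  (c * UnitAddTorus.mFourier n x).re

theorem smoothOnTorus_trigMonomial (n : Fin d → ℤ) (c : ℂ) :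
    SmoothOnTorus (trigMonomial n c) := by
  have h : ContDiff ℝ (⊤ : ℕ∞) fun y : Fin d → ℝ => UnitAddTorus.mFourier n (proj d y) := by
    simp only [UnitAddTorus.mFourier, ContinuousMap.coe_mk, proj, fourier_coe_apply]
    refine contDiff_prod fun i _ => ContDiff.cexp ?_
    refine ContDiff.div_const (contDiff_const.mul ?_) _
    exact Complex.ofRealCLM.contDiff.comp (contDiff_apply ℝ ℝ i)
  exact Complex.reCLM.contDiff.comp (contDiff_const.mul h)

theorem mFourier_add_single (n : Fin d → ℤ) (i : Fin d) (x : Torus d) (t : ℝ) :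
    UnitAddTorus.mFourier n (x + Pi.single i (t : UnitAddCircle))
      = UnitAddTorus.mFourier n x * Complex.exp (2 * Real.pi * Complex.I * n i * t) := by
  have h1 : ∀ y : Torus d, UnitAddTorus.mFourier n y = ∏ j, fourier (n j) (y j) := fun _ => rfl
  have h2 : ∀ j, fourier (n j) ((x + Pi.single i (t : UnitAddCircle) : Torus d) j)
      = fourier (n j) (x j) *
        (fourier (n j) ((Pi.single i (t : UnitAddCircle) : Torus d) j) : ℂ) := by
    intro j
    rw [Pi.add_apply, fourier_apply, smul_add, AddCircle.toCircle_add, Circle.coe_mul,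
      fourier_apply, fourier_apply]
  rw [h1, h1, Finset.prod_congr rfl fun j _ => h2 j, Finset.prod_mul_distrib]
  congr 1
  rw [Finset.prod_eq_single i]
  · rw [Pi.single_eq_same, fourier_coe_apply]
    simp
  · intro j _ hj
    rw [Pi.single_eq_of_ne hj, fourier_eval_zero]
  · simp

theorem partialDeriv_trigMonomial (n : Fin d → ℤ) (c : ℂ) (i : Fin d) :
    partialDeriv (trigMonomial n c) i
      = trigMonomial n (2 * Real.pi * Complex.I * n i * c) := by
  funext x
  have h1 : HasDerivAt (fun t : ℝ => c * (UnitAddTorus.mFourier n x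
      * Complex.exp (2 * Real.pi * Complex.I * n i * t)))
      (c * (UnitAddTorus.mFourier n x * (Complex.exp (2 * Real.pi * Complex.I * n i * (0 : ℝ))
        * (2 * Real.pi * Complex.I * n i * 1)))) 0 :=
    (((Complex.ofRealCLM.hasDerivAt (x := (0 : ℝ))).const_mul
      (2 * Real.pi * Complex.I * n i : ℂ)).cexp.const_mul _).const_mul c
  have h2 := (Complex.reCLM.hasFDerivAt.comp_hasDerivAt (0 : ℝ) h1).deriv
  unfold partialDeriv trigMonomial
  simp only [mFourier_add_single]
  refine h2.trans ?_
  simp only [Complex.ofReal_zero, mul_zero, Complex.exp_zero, one_mul, mul_one,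
    Complex.reCLM_apply]
  congr 1
  ring

theorem partialDeriv_partialDeriv_trigMonomial (n : Fin d → ℤ) (c : ℂ) (i : Fin d)
    (x : Torus d) :
    partialDeriv (partialDeriv (trigMonomial n c) i) i x
      = -((2 * Real.pi * n i) ^ 2 * trigMonomial n c x) := by
  rw [partialDeriv_trigMonomial, partialDeriv_trigMonomial, trigMonomial, trigMonomial]
  have e : (2 * Real.pi * Complex.I * n i * (2 * Real.pi * Complex.I * n i * c)
      * UnitAddTorus.mFourier n x : ℂ)
      = ((-(2 * Real.pi * n i) ^ 2 : ℝ) : ℂ) * (c * UnitAddTorus.mFourier n x) := by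
    push_cast
    linear_combination (2 * Real.pi * n i : ℂ) ^ 2 * c * UnitAddTorus.mFourier n x * Complex.I_sq
  rw [e, Complex.re_ofReal_mul]
  ring

/-- The functional `φ ↦ ∫ f φ` kills every character, hence every continuous function by density of
their span, and continuous functions are dense in `L²`. -/
theorem L2.eq_zero_of_integral_mul_trigMonomial (f : L2 d)
    (h : ∀ n c, ∫ x, f x * trigMonomial n c x = 0) : f = 0 := by
  have hfc : MemLp (fun x => (f x : ℂ)) 2 volume := (Lp.memLp f).ofReal
  let T : C(Torus d, ℂ) →L[ℂ] ℂ :=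
    (innerSL ℂ hfc.toLp).comp (ContinuousMap.toLp (E := ℂ) 2 volume ℂ)
  have hTa : ∀ φ : C(Torus d, ℂ), T φ = ∫ x, (f x : ℂ) * φ x := by
    intro φ
    change inner ℂ hfc.toLp (ContinuousMap.toLp (E := ℂ) 2 volume ℂ φ) = _
    rw [L2.inner_def]
    refine integral_congr_ae ?_
    filter_upwards [hfc.coeFn_toLp, ContinuousMap.coeFn_toLp (p := 2) (𝕜 := ℂ) volume φ]
      with x h1 h2
    rw [h1, h2, RCLike.inner_apply, mul_comm]
    simp
  have hint : ∀ φ : C(Torus d, ℂ), Integrable (fun x => (f x : ℂ) * φ x) volume := fun φ =>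
    hfc.integrable_mul (memLp_of_continuous φ.continuous 2)
  have hre : ∀ φ : C(Torus d, ℂ), (T φ).re = ∫ x, f x * (φ x).re := by
    intro φ
    rw [hTa]
    have := integral_re (hint φ)
    simp only [RCLike.re_to_complex, Complex.re_ofReal_mul] at this
    exact this.symm
  have h0 : ∀ n, T (UnitAddTorus.mFourier n) = 0 := by
    intro n
    have key : ∀ c : ℂ, (c * T (UnitAddTorus.mFourier n)).re = 0 := by
      intro c
      rw [← smul_eq_mul, ← map_smul, hre]
      exact h n c
    refine Complex.ext ?_ ?_
    -- The complex coefficient `c` recovers both parts: `c = 1` the real one, `c = -I` the imaginary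
    -- one.
    · simpa using key 1
    · simpa using key (-Complex.I)
  have hT0 : ∀ φ, T φ = 0 := by
    intro φ
    have hle : (Submodule.span ℂ (Set.range (UnitAddTorus.mFourier (d := Fin d)))).topologicalClosure
        ≤ LinearMap.ker T.toLinearMap := by
      refine Submodule.topologicalClosure_minimal _ (Submodule.span_le.2 ?_) T.isClosed_ker
      rintro _ ⟨n, rfl⟩
      exact h0 n
    rw [UnitAddTorus.span_mFourier_closure_eq_top] at hle
    exact hle (Submodule.mem_top (x := φ))
  have hd := ContinuousMap.toLp_denseRange ℝ (volume : Measure (Torus d)) ℝ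
    (p := 2) (by simp)
  have hcl : ∀ g : L2 d, inner ℝ f g = 0 := by
    intro g
    refine hd.induction_on (p := fun g => inner ℝ f g = 0) g
      (isClosed_eq (by fun_prop) continuous_const) fun φ => ?_
    have h1 := hre ⟨fun x => (φ x : ℂ), by fun_prop⟩
    rw [hT0, L2.inner_def] at *
    simp only [Complex.zero_re, ContinuousMap.coe_mk, Complex.ofReal_re] at h1
    rw [h1]
    refine integral_congr_ae ?_
    filter_upwards [ContinuousMap.coeFn_toLp (p := 2) (𝕜 := ℝ) volume φ] with x h2
    rw [h2]
    simp [mul_comm]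
  exact inner_self_eq_zero.1 (hcl f)

/-! ### `H¹` is complete, and smooth functions are dense in it -/

theorem integral_coord_mul (g : L2Vec d) (i : Fin d) {φ : Torus d → ℝ} (hφ : Continuous φ) :
    ∫ x, g x i * φ x = inner ℝ g (memLp_of_continuous
      (hφ.smul (continuous_const (y := EuclideanSpace.single i (1 : ℝ)))) 2).toLp := by
  rw [L2.inner_def]
  refine integral_congr_ae ?_
  filter_upwards [(memLp_of_continuous
    (hφ.smul (continuous_const (y := EuclideanSpace.single i (1 : ℝ)))) 2).coeFn_toLp] with x hx
  rw [hx, Pi.smul_apply', inner_smul_right, EuclideanSpace.inner_single_right]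
  simp [mul_comm]

theorem integral_mul_continuous (f : L2 d) {φ : Torus d → ℝ} (hφ : Continuous φ) :
    ∫ x, f x * φ x = inner ℝ f (memLp_of_continuous hφ 2).toLp := by
  rw [← L2.integral_mul]
  refine integral_congr_ae ?_
  filter_upwards [(memLp_of_continuous hφ 2).coeFn_toLp] with x hx
  rw [hx]

/-- Each weak-gradient condition equates two continuous functionals. The resulting completeness is
what Banach-Steinhaus and Riesz representation require. -/
theorem isClosed_H1 (d : ℕ) : IsClosed (H1 d : Set (WithLp 2 (L2 d × L2Vec d))) := by
  have e : (H1 d : Set (WithLp 2 (L2 d × L2Vec d))) = ⋂ (φ : Torus d → ℝ) (_ : SmoothOnTorus φ)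
      (i : Fin d), {w | ∫ x, w.fst x * partialDeriv φ i x = -∫ x, w.snd x i * φ x} := by
    ext w
    simp only [Set.mem_iInter, Set.mem_ofPred_eq]
    rfl
  rw [e]
  refine isClosed_iInter fun φ => isClosed_iInter fun hφ => isClosed_iInter fun i => ?_
  simp only [fun f : L2 d => integral_mul_continuous f (hφ.continuous_partialDeriv i),
    fun g : L2Vec d => integral_coord_mul g i hφ.continuous]
  exact isClosed_eq ((WithLp.continuous_fst 2 _ _).inner continuous_const)
    ((WithLp.continuous_snd 2 _ _).inner continuous_const).neg

instance completeSpace_H1 (d : ℕ) : CompleteSpace (H1 d) :=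
  (isClosed_H1 d).completeSpace_coe

theorem H1.inner_toH1 (r : H1 d) {φ : Torus d → ℝ} (hφ : SmoothOnTorus φ) :
    inner ℝ r hφ.toH1 = (∫ x, r.1.fst x * φ x)
      + ∑ i, ∫ x, r.1.snd x i * partialDeriv φ i x := by
  rw [integral_mul_continuous _ hφ.continuous, ← integral_finsetSum _ fun i _ =>
    integrable_mul_of_continuous (memLp_coord r.1.snd i) (hφ.continuous_partialDeriv i)]
  rw [Submodule.coe_inner, WithLp.prod_inner_apply]
  congr 1
  change inner ℝ r.1.snd (memLp_of_continuous hφ.continuous_torusGrad 2).toLp = _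
  rw [L2.inner_def]
  refine integral_congr_ae ?_
  filter_upwards [(memLp_of_continuous hφ.continuous_torusGrad 2).coeFn_toLp] with x hx
  rw [hx, PiLp.inner_apply]
  refine Finset.sum_congr rfl fun i _ => ?_
  simp [torusGrad, mul_comm]

/-- Smooth functions are dense in `H¹`: an element orthogonal to all of them vanishes. -/
theorem H1.eq_zero_of_inner_toH1 (r : H1 d)
    (h : ∀ (φ : Torus d → ℝ) (hφ : SmoothOnTorus φ), inner ℝ r hφ.toH1 = 0) : r = 0 := by
  have hr : HasWeakGradient r.1.fst r.1.snd := r.2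
  have hfst : r.1.fst = 0 := by
    refine L2.eq_zero_of_integral_mul_trigMonomial _ fun n c => ?_
    have hφ := smoothOnTorus_trigMonomial n c
    have h1 := h _ hφ
    rw [H1.inner_toH1] at h1
    -- Taking `∂ᵢ` of the monomial as test function in the weak gradient produces its Laplacian
    -- eigenvalue. Orthogonality then reads `(1 + 4π²|n|²)` times a Fourier coefficient equals zero.
    have h2 : ∀ i, ∫ x, r.1.snd x i * partialDeriv (trigMonomial n c) i x
        = (2 * Real.pi * n i) ^ 2 * ∫ x, r.1.fst x * trigMonomial n c x := by
      intro i
      have h3 := hr _ (hφ.partialDeriv i) i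
      have h4 : ∀ x, r.1.fst x * partialDeriv (partialDeriv (trigMonomial n c) i) i x
          = -((2 * Real.pi * n i) ^ 2 * (r.1.fst x * trigMonomial n c x)) := by
        intro x
        rw [partialDeriv_partialDeriv_trigMonomial]
        ring
      simp only [h4] at h3
      rw [integral_neg, integral_const_mul] at h3
      linarith
    simp only [h2, ← Finset.sum_mul] at h1
    have h5 : 0 ≤ ∑ i, (2 * Real.pi * n i : ℝ) ^ 2 := Finset.sum_nonneg fun i _ => sq_nonneg _
    have h6 : (1 + ∑ i, (2 * Real.pi * n i : ℝ) ^ 2)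
        * ∫ x, r.1.fst x * trigMonomial n c x = 0 := by linarith
    exact (mul_eq_zero.1 h6).resolve_left (by positivity)
  have hsnd : ∀ i, ∀ᵐ x, r.1.snd x i = 0 := by
    intro i
    have h1 := L2.eq_zero_of_integral_mul_trigMonomial (memLp_coord r.1.snd i).toLp ?_
    · filter_upwards [(memLp_coord r.1.snd i).coeFn_toLp,
        Lp.coeFn_zero ℝ 2 (volume : Measure (Torus d))] with x e1 e2
      rw [← e1, h1, e2]
      rfl
    · intro n c
      have h2 := hr _ (smoothOnTorus_trigMonomial n c) i
      have h3 : ∫ x, r.1.fst x * partialDeriv (trigMonomial n c) i x = 0 := by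
        rw [hfst]
        refine integral_eq_zero_of_ae ?_
        filter_upwards [Lp.coeFn_zero ℝ 2 (volume : Measure (Torus d))] with x e2
        simp
      have h4 : ∫ x, (memLp_coord r.1.snd i).toLp _ x * trigMonomial n c x
          = ∫ x, r.1.snd x i * trigMonomial n c x := by
        refine integral_congr_ae ?_
        filter_upwards [(memLp_coord r.1.snd i).coeFn_toLp] with x e1
        rw [e1]
      rw [h4]
      linarith
  have hsnd' : r.1.snd = 0 := by
    refine Lp.ext ?_
    filter_upwards [ae_all_iff.2 hsnd, Lp.coeFn_zero (Vec d) 2 (volume : Measure (Torus d))]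
      with x e1 e2
    rw [e2]
    ext i
    exact e1 i
  exact Subtype.ext ((WithLp.ext_iff 2).2 (Prod.ext hfst hsnd'))

/-! ### Extension to all directions and conclusion -/

theorem exists_strongDual_of_tendsto {E : Type*} [NormedAddCommGroup E] [NormedSpace ℝ E]
    [CompleteSpace E] (T : ℕ → StrongDual ℝ E) {f : E → ℝ}
    (h : ∀ v, Tendsto (fun N => T N v) atTop (𝓝 (f v))) : ∃ L : StrongDual ℝ E, ∀ v, L v = f v :=
  ⟨continuousLinearMapOfTendsto T (tendsto_pi_nhds.2 h), fun _ => rfl⟩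

/-- Truncating `b` to `{‖b‖ ≤ N}` gives bounded functionals, which converge pointwise by dominated
convergence. Banach-Steinhaus makes the limit bounded although `b` need not be in `L²`. -/
theorem exists_strongDual_eq_integral_inner {b : Torus d → Vec d} (hb : AEStronglyMeasurable b volume)
    (hint : ∀ v : H1 d, Integrable (fun x => inner ℝ (b x) (v.1.snd x)) volume) :
    ∃ L : StrongDual ℝ (H1 d), ∀ v, L v = ∫ x, inner ℝ (b x) (v.1.snd x) := by
  -- A strongly measurable representative makes the truncation sets measurable.
  wlog hbm : StronglyMeasurable b generalizing b
  · have hae : ∀ v : H1 d, (fun x => inner ℝ (b x) (v.1.snd x)) =ᵐ[volume]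
        fun x => inner ℝ (hb.mk b x) (v.1.snd x) := fun v => by
      filter_upwards [hb.ae_eq_mk] with x hx
      rw [hx]
    obtain ⟨L, hL⟩ := this hb.stronglyMeasurable_mk.aestronglyMeasurable
      (fun v => (hint v).congr (hae v)) hb.stronglyMeasurable_mk
    exact ⟨L, fun v => (hL v).trans (integral_congr_ae (hae v)).symm⟩
  let S : ℕ → Set (Torus d) := fun N => {x | ‖b x‖ ≤ N}
  have hS : ∀ N, MeasurableSet (S N) := fun N =>
    measurableSet_le hbm.norm.measurable measurable_const
  have hmem : ∀ N, MemLp ((S N).indicator b) 2 volume := fun N => by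
    refine MemLp.of_bound (hb.indicator (hS N)) N (ae_of_all _ fun x => ?_)
    by_cases hx : x ∈ S N
    · rw [Set.indicator_of_mem hx]
      exact hx
    · rw [Set.indicator_of_notMem hx, norm_zero]
      positivity
  let P : H1 d →L[ℝ] L2Vec d := (WithLp.sndL 2 ℝ (L2 d) (L2Vec d)).comp (H1 d).subtypeL
  let T : ℕ → H1 d →L[ℝ] ℝ := fun N => (innerSL ℝ (hmem N).toLp).comp P
  have hT : ∀ N v, T N v = ∫ x, inner ℝ ((S N).indicator b x) (v.1.snd x) := by
    intro N v
    change inner ℝ (hmem N).toLp v.1.snd = _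
    rw [L2.inner_def]
    refine integral_congr_ae ?_
    filter_upwards [(hmem N).coeFn_toLp] with x hx
    rw [hx]
  refine exists_strongDual_of_tendsto T fun v => ?_
  simp only [hT]
  refine tendsto_integral_of_dominated_convergence
    (fun x => ‖(inner ℝ (b x) (v.1.snd x) : ℝ)‖)
    (fun N => (hb.indicator (hS N)).inner (Lp.aestronglyMeasurable _)) (hint v).norm
    (fun N => ae_of_all _ fun x => ?_) (ae_of_all _ fun x => ?_)
  · by_cases hx : x ∈ S N <;> simp [hx]
  · refine tendsto_const_nhds.congr' ?_
    filter_upwards [eventually_ge_atTop ⌈‖b x‖⌉₊] with N hN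
    have hx : x ∈ S N := (Nat.le_ceil _).trans (Nat.cast_le.2 hN)
    rw [Set.indicator_of_mem hx]

/-- If the Fokker-Planck equation holds against smooth functions, and the integrals converge for
all directions, then it holds for all directions. -/
theorem integral_integrandFP_eq_zero_of_smooth {H : Vec d → ℝ → ℝ} {z : X d}
    (hmeas : AEStronglyMeasurable (driftField H z) volume)
    (hsm : ∀ (φ : Torus d → ℝ) (hφ : SmoothOnTorus φ), ∫ x, integrandFP H z hφ.toX x = 0)
    (hint : ∀ w : X d, Integrable (integrandFP H z w) volume) (w : X d) :
    ∫ x, integrandFP H z w x = 0 := by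
  have e0 : ∀ w : X d, ∀ x, integrandFP H z w x
      = inner ℝ (z.m x • driftField H z x) (w.Du x) + (z.m x - 1) * w.u x := fun w x => by
    rw [integrandFP, real_inner_smul_left, driftField]
  have hi : ∀ w : X d, Integrable (fun x => inner ℝ (z.m x • driftField H z x) (w.Du x))
      volume := fun w => by
    refine ((hint w).sub (integrable_FP_lower z w)).congr (ae_of_all _ fun x => ?_)
    rw [Pi.sub_apply, e0]
    ring
  obtain ⟨L, hL⟩ := exists_strongDual_eq_integral_inner
    (b := fun x => z.m x • driftField H z x) (z.memLp_m.aestronglyMeasurable.smul hmeas)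
    (fun v => hi (WithLp.toLp 2 (0, v)))
  have hm1 : MemLp (fun x => z.m x - 1) 2 volume := z.memLp_m.sub (memLp_const 1)
  let Q : H1 d →L[ℝ] L2 d := (WithLp.fstL 2 ℝ (L2 d) (L2Vec d)).comp (H1 d).subtypeL
  let L' : StrongDual ℝ (H1 d) := L + (innerSL ℝ hm1.toLp).comp Q
  have hL' : ∀ w : X d, ∫ x, integrandFP H z w x = L' w.snd := by
    intro w
    simp only [e0]
    rw [integral_add (hi w) (integrable_FP_lower z w)]
    change _ = L w.snd + inner ℝ hm1.toLp w.snd.1.fst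
    rw [hL, ← L2.integral_mul]
    congr 1
    refine integral_congr_ae ?_
    filter_upwards [hm1.coeFn_toLp] with x hx
    rw [hx]
    rfl
  -- The Riesz representative of the Fokker-Planck functional is orthogonal to all smooth functions.
  have hr : (InnerProductSpace.toDual ℝ (H1 d)).symm L' = 0 := by
    refine H1.eq_zero_of_inner_toH1 _ fun φ hφ => ?_
    rw [InnerProductSpace.toDual_symm_apply]
    exact (hL' hφ.toX).symm.trans (hsm φ hφ)
  rw [hL', (LinearIsometryEquiv.map_eq_zero_iff _).1 hr]
  rfl

theorem smoothOnTorus_const (c : ℝ) : SmoothOnTorus (fun _ : Torus d => c) := contDiff_const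

theorem integral_integrandFP_toX {H : Vec d → ℝ → ℝ} {z : X d}
    (hz : Integrable (fun x => z.m x • driftField H z x) volume) {φ : Torus d → ℝ}
    (hφ : SmoothOnTorus φ) :
    ∫ x, integrandFP H z hφ.toX x = (∫ x, z.m x * φ x)
      + (∫ x, z.m x * inner ℝ (gradP H (z.Du x) (z.m x)) (torusGrad φ x)) - ∫ x, φ x := by
  have h1 : Integrable (fun x => z.m x * φ x) volume :=
    integrable_mul_of_continuous z.memLp_m hφ.continuous
  have h2 : Integrable φ volume := memLp_one_iff_integrable.1 (memLp_of_continuous hφ.continuous 1)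
  have h3 : Integrable (fun x => z.m x * inner ℝ (gradP H (z.Du x) (z.m x)) (torusGrad φ x))
      volume := by
    obtain ⟨C, hC⟩ := isCompact_univ.exists_bound_of_continuousOn
      hφ.continuous_torusGrad.continuousOn
    refine (hz.norm.mul_const C).mono' ?_ (ae_of_all _ fun x => ?_)
    · refine (hz.aestronglyMeasurable.inner (𝕜 := ℝ)
        hφ.continuous_torusGrad.aestronglyMeasurable).congr (ae_of_all _ fun x => ?_)
      simp only [real_inner_smul_left, driftField]
    · rw [← real_inner_smul_left]
      exact (norm_inner_le_norm _ _).trans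
        (mul_le_mul_of_nonneg_left (hC x trivial) (norm_nonneg _))
  have h13 : Integrable (fun x => z.m x * φ x
      + z.m x * inner ℝ (gradP H (z.Du x) (z.m x)) (torusGrad φ x)) volume := h1.add h3
  rw [← integral_add h1 h3, ← integral_sub h13 h2]
  refine integral_congr_ae ?_
  filter_upwards [hφ.toX_u, hφ.toX_Du] with x e1 e2
  rw [integrandFP, e1, e2]
  ring

end MFG

end

theorem proposition4p2 {d : ℕ} (H : MFG.Vec d → ℝ → ℝ) (hH : MFG.StructuralAssumptions H)
    (V : MFG.Torus d → ℝ) (hV : MemLp V ⊤ (volume : Measure (MFG.Torus d)))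
    (ε : ℕ → ℝ) (hε : ∀ n, 0 < ε n) (hε₀ : Tendsto ε atTop (𝓝 0))
    (z : ℕ → MFG.X d) (hz : ∀ n, MFG.IsRegularisedSolution H V (ε n) (z n))
    (z₀ : MFG.X d)
    (hm : MFG.WeaklyTendsto (fun n => (z n).fst) z₀.fst)
    (hu : MFG.WeaklyTendsto (fun n => (z n).snd) z₀.snd) :
    z₀ ∈ MFG.K d ∧ MFG.OperatorValue H V z₀ 0 ∧
      ((∀ w, MFG.PairingConverges H V z₀ w) → ∀ w, MFG.pairingA H V z₀ w = 0) ∧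
      MFG.IsStrongSolution H V z₀ := by
  have hlim : Tendsto z atTop (𝓝 z₀) := MFG.tendsto_of_isRegularisedSolution hH hε hε₀ hz
    (MFG.tendsto_inner_of_weaklyTendsto hm hu)
  have hnn := MFG.nonneg_of_tendsto hlim fun n => (hz n).nonneg
  have hHJ := MFG.hamiltonJacobi_of_tendsto hH hε₀ hlim hz
  have hFP : ∀ w : MFG.X d, MemLp w.Du ⊤ volume → ∫ x, MFG.integrandFP H z₀ w x = 0 :=
    fun w hw => MFG.integral_integrandFP_eq_zero hH hε₀ hlim hz hw
  have hHJ0 : ∀ w : MFG.X d, MFG.integrandHJ H V z₀ w =ᵐ[volume] 0 := fun w => by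
    filter_upwards [hHJ] with x hx
    simp [MFG.integrandHJ, hx]
  have hHJint : ∀ w : MFG.X d, ∫ x, MFG.integrandHJ H V z₀ w x = 0 := fun w =>
    integral_eq_zero_of_ae (hHJ0 w)
  have hflux := MFG.integrable_smul_driftField hH hnn
  have hweak : ∀ φ : MFG.Torus d → ℝ, MFG.SmoothOnTorus φ →
      (∫ x, z₀.m x * φ x)
        + (∫ x, z₀.m x * inner ℝ (MFG.gradP H (z₀.Du x) (z₀.m x)) (MFG.torusGrad φ x))
        = ∫ x, φ x := fun φ hφ => by
    have h := hFP hφ.toX hφ.memLp_toX_Du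
    rw [MFG.integral_integrandFP_toX hflux hφ] at h
    linarith
  have hK : z₀ ∈ MFG.K d := by
    refine ⟨hnn, ?_⟩
    -- The constant test function has zero gradient, so the equation reduces to `∫ m = 1`.
    have h := hweak _ (MFG.smoothOnTorus_const 1)
    have hgrad : ∀ x, MFG.torusGrad (fun _ : MFG.Torus d => (1 : ℝ)) x = 0 := fun x => by
      ext i
      simp [MFG.torusGrad, MFG.partialDeriv]
    simpa [hgrad] using h
  refine ⟨hK, fun w hw => ⟨⟨?_, MFG.integrable_integrandFP hH hnn hw.2⟩, ?_⟩, fun hc w => ?_,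
    hK, hHJ, hflux, hweak⟩
  · exact (integrable_zero _ _ _).congr (hHJ0 w).symm
  · rw [MFG.pairingA, hHJint, hFP w hw.2]
    simp
  · rw [MFG.pairingA, hHJint, zero_add]
    exact MFG.integral_integrandFP_eq_zero_of_smooth
      (MFG.memLp_driftField hH hnn).aestronglyMeasurable
      (fun φ hφ => hFP hφ.toX hφ.memLp_toX_Du) (fun w => (hc w).2) w
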